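/- **Theorem 5.3.** Let $M\in\mathbb N$ and, for every $n\in\mathbb N=\{1,2,\dots\}$, let $\mathbf d_n=(d_{n,1},\dots,d_{n,n})$ be a deterministic degree sequence with even sum and $3\le d_{n,i}\le M$ for all $i\in[n]=\{1,\dots,n\}$. Let $G_n=\mathrm{CM}_n(\mathbf d_n)$ be the configuration model: vertex $i$ carries $d_{n,i}$ half-edges, and $G_n$ is the random multigraph on $[n]$ obtained from a uniformly random perfect matching of all half-edges. Given $G_n$, the non-backtracking random walk started at $i\in[n]$ first leaves $i$ along a uniformly chosen half-edge at $i$. Whenever it crosses an edge and enters a vertex $v$ through a half-edge $g$ at $v$, it next leaves $v$ along a uniformly chosen one of the $d_{n,v}-1$ half-edges at $v$ other than $g$. Let $P_n^{(k)}(i,j)$ be the probability, given $G_n$, that the walk started at $i$ is at $j$ after $k$ steps, with $P_n^{(0)}(i,j)=\mathbb 1_{\{i=j\}}$, and put $$\Delta_{i,n}^{(k)}=\sum_{j\in[n]}P_n^{(k)}(i,j)\,d_{n,j}-d_{n,i},\qquad \mu_n^{(k)}=\frac1n\sum_{i\in[n]}\delta_{\Delta_{i,n}^{(k)}}.$$ Let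 $D_n$ be the degree of a uniformly chosen vertex of $[n]$, and suppose that $D_n\Longrightarrow D$ for a random variable $D$ with values in $\mathbb N_0$ and $\mathbb P\{D\ge1\}=1$. Let $d_{\max}=d_{\max}(n)=\max_{i\in[n]}d_{n,i}$, and let $m_n$ be positive integers with $m_n=o\big(\sqrt{n/d_{\max}}\big)$ as $n\to\infty$. Let $k_n\in\mathbb N_0$ satisfy $k_n\to\infty$ and $$k_n\le\frac{\log m_n}{2\log M}\qquad\text{for all sufficiently large }n.$$ Then $\mu_n^{(k_n)}\Longrightarrow\mu$ in distribution as $n\to\infty$, where $\mu$ is the law of $$\Delta_\phi=\frac{\mathbb E[D^2]}{\mathbb E[D]}-d_\phi ,\qquad d_\phi\overset{d}{=}D.$$ That is, as random elements of the space of probability measures on $\mathbb R$ with the topology of weak convergence, the $\mu_n^{(k_n)}$ converge in distribution to the deterministic element $\mu$: $\mathbb E_n\big[\Phi(\mu_n^{(k_n)})\big]\to\Phi(\mu)$ for every bounded continuous real function $\Phi$ on that space, with $\mathbb E_n$ the expectation over $G_n$. -/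

import Mathlib

open MeasureTheory ProbabilityTheory Filter Topology
open scoped BoundedContinuousFunction ENNReal

noncomputable section

namespace FriendshipBias

section ConfigurationModel

variable {V : Type*}

/-- The half-edges of the degree sequence `d`: vertex `v` carries `d v` of them. -/
abbrev HalfEdge (d : V → ℕ) : Type _ := Σ v : V, Fin (d v)

/-- A perfect matching of the half-edges, i.e. a fixed-point-free involution `σ`. It encodes the
multigraph on `V` with one edge for every matched pair `{h, σ h}` of half-edges, joining the vertices
`h.1` and `(σ h).1` (a self-loop if these coincide). A self-loop counts twice in the degree, so the
degree of `v` in this multigraph is `d v`. -/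
def Pairing (d : V → ℕ) : Type _ :=
  {σ : HalfEdge d → HalfEdge d // Function.Involutive σ ∧ ∀ h, σ h ≠ h}

/-- All sets of pairings are events. -/
instance (d : V → ℕ) : MeasurableSpace (Pairing d) := ⊤

/-- The law of the configuration model with degree sequence `d`: the uniform distribution on the
perfect matchings of the half-edges. -/
def configurationModel (d : V → ℕ) : Measure (Pairing d) := uniformOn Set.univ

variable [Fintype V] [DecidableEq V]

/-- `stepLaw σ i k h` is the probability that the non-backtracking random walk started at the vertex
`i` leaves along the half-edge `h` in its step number `k + 1` (so that it enters the vertex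
`(σ.1 h).1`). The first half-edge is uniform among the `d i` half-edges at `i`; having crossed the
half-edge `h'`, the walk leaves along a uniform half-edge at the vertex `(σ.1 h').1`, other than the
half-edge `σ.1 h'` through which it has just entered. -/
def stepLaw {d : V → ℕ} (σ : Pairing d) (i : V) : ℕ → HalfEdge d → ℝ
  | 0, h => if h.1 = i then 1 / (d i : ℝ) else 0
  | k + 1, h => ∑ h' : HalfEdge d,
      stepLaw σ i k h' * (if h.1 = (σ.1 h').1 ∧ h ≠ σ.1 h' then 1 / ((d h.1 : ℝ) - 1) else 0)

/-- The probability `P^{(k)}(i, j)` that the non-backtracking random walk started at the vertex `i` is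
at the vertex `j` after `k` steps. -/
def transitionProb {d : V → ℕ} (σ : Pairing d) : ℕ → V → V → ℝ
  | 0, i, j => if i = j then 1 else 0
  | k + 1, i, j => ∑ h : HalfEdge d, if (σ.1 h).1 = j then stepLaw σ i k h else 0

/-- The `k`-level friendship bias of the vertex `i`. -/
def bias {d : V → ℕ} (σ : Pairing d) (k : ℕ) (i : V) : ℝ :=
  ∑ j : V, transitionProb σ k i j * (d j : ℝ) - (d i : ℝ)

/-- The `k`-level (quenched) friendship-bias empirical distribution, `1/|V| ∑ i, δ_{bias i}`. -/
def biasEmpirical [Nonempty V] {d : V → ℕ} (σ : Pairing d) (k : ℕ) : ProbabilityMeasure ℝ :=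
  ⟨(Fintype.card V : ℝ≥0∞)⁻¹ • ∑ i : V, Measure.dirac (bias σ k i), ⟨by
    simp [ENNReal.inv_mul_cancel]⟩⟩

end ConfigurationModel

/-- The law of `E[D²] / E[D] - D`. -/
def limitLaw {Ω : Type*} [MeasurableSpace Ω] (P : Measure Ω) [IsProbabilityMeasure P] (D : Ω → ℕ)
    (hD : Measurable D) : ProbabilityMeasure ℝ :=
  ⟨P.map fun ω => (∫ ω', (D ω' : ℝ) ^ 2 ∂P) / (∫ ω', (D ω' : ℝ) ∂P) - (D ω : ℝ),
    Measure.isProbabilityMeasure_map (by fun_prop)⟩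

/-- The random probability measures `X n`, defined on the probability spaces `(Ω n, P n)`, converge in
distribution to the deterministic probability measure `μ`, as random elements of the space of
probability measures on `ℝ` with the topology of weak convergence: `E_n[Φ (X n)] → Φ μ` for every
bounded continuous function `Φ` on that space. (It is only used for spaces `Ω n` that are finite and
all of whose subsets are events, so that no measurability has to be required.) -/
def RandomMeasureTendstoInDistribution {ι : Type*} {Ω : ι → Type*} [∀ n, MeasurableSpace (Ω n)]
    (P : ∀ n, Measure (Ω n)) (X : ∀ n, Ω n → ProbabilityMeasure ℝ) (l : Filter ι)
    (μ : ProbabilityMeasure ℝ) : Prop :=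
  ∀ Φ : ProbabilityMeasure ℝ →ᵇ ℝ, Tendsto (fun n => ∫ ω, Φ (X n ω) ∂(P n)) l (𝓝 (Φ μ))

end FriendshipBias

end

noncomputable section

namespace FriendshipBias

/-! ### Uniform matchings revealed edge by edge -/

section Matchings

variable {V : Type*} {d : V → ℕ}

/-! Let `S` be composition with the matching, `T` the averaging operator `turn d`, and `c` the
size-biased mean degree, so that `g h = d h.1 - c` has sum zero over the half-edges. The walk's mean
degree after `k + 1` steps, less `c`, is an average of `(S T)^k S g` over the half-edges at the
starting vertex. It therefore suffices that the squared ℓ² norm of this function, divided by `n` and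
averaged over matchings, tends to zero: the bias at `i` is then close in mean square to `c - d i`,
whose empirical law converges because the degrees do.

`S` is a permutation and `T` is symmetric and doubly stochastic, so this norm decreases in `k`.
Splitting `T²` into diagonal and off-diagonal parts sharpens this: minimum degree 3 bounds the
diagonal by 1/2, and symmetry turns the off-diagonal part into `⟨g, W g⟩` with `W` a word of length
`2k + 1` (`normSq_succ_le`). Every kernel in `W` leaves its half-edge, so evaluating `W g` explores
fresh edges unless the exploration meets a vertex already seen. Such a collision has probability
`O(1/l)` per edge, `l` being the number of half-edges. Without collisions, the last partner is
uniform over the unrevealed half-edges, where `g` nearly averages to zero. Hence `W g` has mean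
`O(k²/l)` pointwise (`Reveals.abs_sum_word_le`), and iterating gives the bound `2⁻ᵏ l G² + O(k³)` of
`sum_normSq_le`.

By monotonicity a fixed `K` may replace `k n`; first `n → ∞`, then `K → ∞`. A Markov-type estimate
transfers convergence along matchings with small error to expectations of `Φ`. -/

@[ext]
theorem Pairing.ext {σ τ : Pairing d} (h : ∀ x, σ.1 x = τ.1 x) : σ = τ :=
  Subtype.ext (funext h)

theorem Pairing.apply_apply (σ : Pairing d) (x : HalfEdge d) : σ.1 (σ.1 x) = x := σ.2.1 x

/-- The matching obtained by relabelling the half-edges. -/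
def Pairing.conj (e : Equiv.Perm (HalfEdge d)) (σ : Pairing d) : Pairing d :=
  ⟨fun x => e (σ.1 (e.symm x)), fun x => by simp [σ.apply_apply], fun x hx => by
    exact σ.2.2 (e.symm x) ((Equiv.eq_symm_apply e).mpr hx)⟩

theorem Pairing.conj_apply (e : Equiv.Perm (HalfEdge d)) (σ : Pairing d) (x : HalfEdge d) :
    (σ.conj e).1 x = e (σ.1 (e.symm x)) := rfl

theorem Pairing.nonempty_of_even [Fintype V] (h : Even (∑ v, d v)) : Nonempty (Pairing d) := by
  obtain ⟨r, hr⟩ := h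
  have hc : Fintype.card (HalfEdge d) = Fintype.card (Fin r ⊕ Fin r) := by simp [hr]
  let e := Fintype.equivOfCardEq hc
  refine ⟨⟨fun x => e.symm (e x).swap, fun x => by simp, fun x hx => ?_⟩⟩
  have : (e x).swap = e x := e.symm_apply_eq.mp hx
  rcases h : e x with a | a <;> simp [h] at this

variable [DecidableEq V]

/-- `E` is an event on which the half-edges of `T` are matched among themselves, and that does not
distinguish between the half-edges outside `T`. -/
structure Reveals (T : Finset (HalfEdge d)) (E : Finset (Pairing d)) : Prop where
  mapsTo : ∀ σ ∈ E, ∀ x ∈ T, σ.1 x ∈ T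
  conj_mem : ∀ σ ∈ E, ∀ y ∉ T, ∀ z ∉ T, σ.conj (Equiv.swap y z) ∈ E

/-- The matchings in `E` that match `x` with `y`. -/
def matchedTo (E : Finset (Pairing d)) (x y : HalfEdge d) : Finset (Pairing d) :=
  E.filter fun σ => σ.1 x = y

theorem mem_matchedTo {E : Finset (Pairing d)} {x y : HalfEdge d} {σ : Pairing d} :
    σ ∈ matchedTo E x y ↔ σ ∈ E ∧ σ.1 x = y := by
  simp [matchedTo]

variable {T : Finset (HalfEdge d)} {E : Finset (Pairing d)}

theorem Reveals.apply_notMem (h : Reveals T E) {σ : Pairing d} (hσ : σ ∈ E) {x : HalfEdge d}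
    (hx : x ∉ T) : σ.1 x ∉ insert x T := by
  rw [Finset.mem_insert, not_or]
  refine ⟨σ.2.2 x, fun hT => hx ?_⟩
  simpa [σ.apply_apply] using h.mapsTo σ hσ _ hT

theorem Reveals.restrict (h : Reveals T E) (x y : HalfEdge d) :
    Reveals (insert y (insert x T)) (matchedTo E x y) := by
  refine ⟨fun σ hσ z hz => ?_, fun σ hσ z hz w hw => ?_⟩
  · rw [mem_matchedTo] at hσ
    simp only [Finset.mem_insert] at hz ⊢
    rcases hz with rfl | rfl | hz
    · right; left; rw [← hσ.2, σ.apply_apply]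
    · left; exact hσ.2
    · right; right; exact h.mapsTo σ hσ.1 z hz
  · rw [mem_matchedTo] at hσ ⊢
    simp only [Finset.mem_insert, not_or] at hz hw
    refine ⟨h.conj_mem σ hσ.1 z hz.2.2 w hw.2.2, ?_⟩
    rw [Pairing.conj_apply, Equiv.symm_swap,
      Equiv.swap_apply_of_ne_of_ne (Ne.symm hz.2.1) (Ne.symm hw.2.1), hσ.2,
      Equiv.swap_apply_of_ne_of_ne (Ne.symm hz.1) (Ne.symm hw.1)]

/-- Relabelling by the transposition of `y` and `z` injects one class into the other, since `E`
cannot tell unrevealed half-edges apart. By symmetry the two classes have equal size. -/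
theorem Reveals.card_matchedTo_le (h : Reveals T E) {x y z : HalfEdge d}
    (hy : y ∉ insert x T) (hz : z ∉ insert x T) :
    (matchedTo E x y).card ≤ (matchedTo E x z).card := by
  simp only [Finset.mem_insert, not_or] at hy hz
  refine Finset.card_le_card_of_injOn (Pairing.conj (Equiv.swap y z)) (fun σ hσ => ?_)
    (fun σ _ τ _ hστ => ?_)
  · rw [Finset.mem_coe, mem_matchedTo] at hσ ⊢
    refine ⟨h.conj_mem σ hσ.1 y hy.2 z hz.2, ?_⟩
    rw [Pairing.conj_apply, Equiv.symm_swap,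
      Equiv.swap_apply_of_ne_of_ne (Ne.symm hy.1) (Ne.symm hz.1), hσ.2, Equiv.swap_apply_left]
  · ext1 w
    have := congrArg (fun ρ : Pairing d => ρ.1 (Equiv.swap y z w)) hστ
    simpa [Pairing.conj_apply] using this

variable [Fintype V]

instance : Fintype (Pairing d) :=
  haveI : Finite (Pairing d) := by
    classical
    exact inferInstanceAs
      (Finite {σ : HalfEdge d → HalfEdge d // Function.Involutive σ ∧ ∀ h, σ h ≠ h})
  Fintype.ofFinite _

theorem reveals_univ : Reveals (∅ : Finset (HalfEdge d)) Finset.univ :=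
  ⟨by simp, by simp⟩

/-- Conditionally on `E`, the partner of `x ∉ T` is uniform among the other half-edges outside
`T`. -/
theorem Reveals.card_matchedTo_mul (h : Reveals T E) {x y : HalfEdge d} (hx : x ∉ T)
    (hy : y ∉ insert x T) :
    (insert x T)ᶜ.card * (matchedTo E x y).card = E.card := by
  have hm : ∀ σ ∈ E, σ.1 x ∈ (insert x T)ᶜ := fun σ hσ => by
    rw [Finset.mem_compl]
    exact h.apply_notMem hσ hx
  refine Eq.trans ?_ (Finset.card_eq_sum_card_fiberwise hm).symm
  rw [← smul_eq_mul, ← Finset.sum_const]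
  refine Finset.sum_congr rfl fun z hz => le_antisymm ?_ ?_
  · exact h.card_matchedTo_le hy (by simpa using hz)
  · exact h.card_matchedTo_le (by simpa using hz) hy

theorem Reveals.sum_eq (h : Reveals T E) {x : HalfEdge d} (hx : x ∉ T) (f : Pairing d → ℝ) :
    ∑ σ ∈ E, f σ = ∑ y ∈ (insert x T)ᶜ, ∑ σ ∈ matchedTo E x y, f σ :=
  (Finset.sum_fiberwise_of_maps_to (g := fun σ : Pairing d => σ.1 x)
    (fun σ hσ => by rw [Finset.mem_compl]; exact h.apply_notMem hσ hx) f).symm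

end Matchings

/-! ### Words in the matching and local kernels -/

section Words

variable {V : Type*} {d : V → ℕ} [Fintype V]

/-- A substochastic (signed) kernel on the half-edges that moves to another half-edge at the same
vertex. -/
structure IsLocalKernel (A : Matrix (HalfEdge d) (HalfEdge d) ℝ) : Prop where
  ne : ∀ y z, A y z ≠ 0 → z ≠ y
  fst_eq : ∀ y z, A y z ≠ 0 → z.1 = y.1
  sum_le : ∀ y, ∑ z, |A y z| ≤ 1

/-- The operator `S A₁ S A₂ ⋯ S Aᵣ S` applied to `g`, where `S` is the composition with `σ`. -/
def word (σ : Pairing d) : List (Matrix (HalfEdge d) (HalfEdge d) ℝ) → (HalfEdge d → ℝ) →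
    HalfEdge d → ℝ
  | [], g, h => g (σ.1 h)
  | A :: As, g, h => A.mulVec (word σ As g) (σ.1 h)

theorem IsLocalKernel.abs_mulVec_le {A : Matrix (HalfEdge d) (HalfEdge d) ℝ}
    (hA : IsLocalKernel A) {f : HalfEdge d → ℝ} {G : ℝ} {y : HalfEdge d}
    (hf : ∀ z, A y z ≠ 0 → |f z| ≤ G) (hG : 0 ≤ G) : |A.mulVec f y| ≤ G := by
  rw [Matrix.mulVec, dotProduct]
  calc |∑ z, A y z * f z| ≤ ∑ z, |A y z * f z| := Finset.abs_sum_le_sum_abs _ _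
    _ ≤ ∑ z, |A y z| * G := by
        refine Finset.sum_le_sum fun z _ => ?_
        rw [abs_mul]
        by_cases h0 : A y z = 0
        · simp [h0]
        · exact mul_le_mul_of_nonneg_left (hf z h0) (abs_nonneg _)
    _ = (∑ z, |A y z|) * G := by rw [Finset.sum_mul]
    _ ≤ 1 * G := mul_le_mul_of_nonneg_right (hA.sum_le y) hG
    _ = G := one_mul G

theorem abs_word_le (σ : Pairing d) {As : List (Matrix (HalfEdge d) (HalfEdge d) ℝ)}
    (hAs : ∀ A ∈ As, IsLocalKernel A) {g : HalfEdge d → ℝ} {G : ℝ} (hg : ∀ h, |g h| ≤ G)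
    (h : HalfEdge d) : |word σ As g h| ≤ G := by
  induction As generalizing h with
  | nil => exact hg _
  | cons A As ih =>
    exact (hAs A (by simp)).abs_mulVec_le
      (fun z _ => ih (fun B hB => hAs B (by simp [hB])) z) ((abs_nonneg _).trans (hg h))

theorem sum_mulVec {ι : Type*} (s : Finset ι) (A : Matrix (HalfEdge d) (HalfEdge d) ℝ)
    (f : ι → HalfEdge d → ℝ) (y : HalfEdge d) :
    ∑ i ∈ s, A.mulVec (f i) y = A.mulVec (fun z => ∑ i ∈ s, f i z) y := by
  simp only [Matrix.mulVec, dotProduct, Finset.mul_sum]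
  exact Finset.sum_comm

theorem Pairing.sum_comp (σ : Pairing d) (f : HalfEdge d → ℝ) :
    ∑ h, f (σ.1 h) = ∑ h, f h :=
  Equiv.sum_comp σ.2.1.toPerm f

theorem sum_mulVec_mul {A : Matrix (HalfEdge d) (HalfEdge d) ℝ} (hA : A.IsSymm)
    (f g : HalfEdge d → ℝ) : ∑ h, A.mulVec f h * g h = ∑ h, f h * A.mulVec g h := by
  have := Matrix.dotProduct_mulVec f A g
  rw [← Matrix.mulVec_transpose, hA.eq] at this
  exact this.symm

theorem word_append (σ : Pairing d) (As Bs : List (Matrix (HalfEdge d) (HalfEdge d) ℝ))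
    (A : Matrix (HalfEdge d) (HalfEdge d) ℝ) (g : HalfEdge d → ℝ) :
    word σ (As ++ A :: Bs) g = word σ As (A.mulVec (word σ Bs g)) := by
  induction As with
  | nil => rfl
  | cons B As ih =>
    funext h
    rw [List.cons_append, word, ih, word]

/-- The matching operator and all the letters are self-adjoint, so the adjoint of a word is the
reversed word. -/
theorem sum_word_mul (σ : Pairing d) {As : List (Matrix (HalfEdge d) (HalfEdge d) ℝ)}
    (hAs : ∀ A ∈ As, A.IsSymm) (f g : HalfEdge d → ℝ) :
    ∑ h, word σ As g h * f h = ∑ h, g h * word σ As.reverse f h := by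
  induction As generalizing f with
  | nil =>
    rw [← σ.sum_comp]
    simp [word, σ.apply_apply]
  | cons A As ih =>
    rw [List.reverse_cons, word_append, ← ih (fun B hB => hAs B (by simp [hB])),
      ← sum_mulVec_mul (hAs A (by simp)), ← σ.sum_comp]
    simp [word, σ.apply_apply]

variable [DecidableEq V]

theorem card_filter_fst_mem_le {M : ℕ} (hM : ∀ v, d v ≤ M) (T : Finset (HalfEdge d)) :
    (Finset.univ.filter fun y : HalfEdge d => y.1 ∈ T.image Sigma.fst).card ≤ M * T.card := by
  have : (Finset.univ.filter fun y : HalfEdge d => y.1 ∈ T.image Sigma.fst) =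
      (T.image Sigma.fst).sigma fun _ => Finset.univ := by
    ext y; simp
  rw [this, Finset.card_sigma]
  simp only [Finset.card_univ, Fintype.card_fin]
  calc ∑ v ∈ T.image Sigma.fst, d v ≤ (T.image Sigma.fst).card * M := by
        simpa using Finset.sum_le_card_nsmul _ _ M fun v _ => hM v
    _ ≤ M * T.card := by
        rw [mul_comm]
        exact Nat.mul_le_mul_left _ Finset.card_image_le

theorem Reveals.card_matchedTo_le_div {T : Finset (HalfEdge d)} {E : Finset (Pairing d)}
    (h : Reveals T E) {x y : HalfEdge d} (hx : x ∉ T) (hy : y ∉ insert x T)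
    (hT : 2 * (T.card + 1) ≤ Fintype.card (HalfEdge d)) :
    ((matchedTo E x y).card : ℝ) ≤ 2 / Fintype.card (HalfEdge d) * E.card := by
  have h1 := h.card_matchedTo_mul hx hy
  rw [Finset.card_compl, Finset.card_insert_of_notMem hx] at h1
  -- By `hT`, at least half of all half-edges are still available as partners.
  have h2 : Fintype.card (HalfEdge d) * (matchedTo E x y).card ≤ 2 * E.card := by
    rw [← h1, ← mul_assoc]
    exact Nat.mul_le_mul_right _ (by omega)
  have h3 : (0 : ℝ) < Fintype.card (HalfEdge d) := by
    exact_mod_cast (show 0 < Fintype.card (HalfEdge d) by omega)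
  rw [div_mul_eq_mul_div, le_div_iff₀ h3, mul_comm]
  exact_mod_cast h2

theorem Reveals.sum_card_matchedTo {T : Finset (HalfEdge d)} {E : Finset (Pairing d)}
    (h : Reveals T E) {x : HalfEdge d} (hx : x ∉ T) :
    ∑ y ∈ (insert x T)ᶜ, ((matchedTo E x y).card : ℝ) = E.card := by
  simpa using (h.sum_eq hx fun _ => 1).symm

/-- Conditionally on a bounded number of revealed edges, the mean of `word σ As g` at an unrevealed
half-edge is of order `1 / |HalfEdge d|`. -/
theorem Reveals.abs_sum_word_le {M : ℕ} (hM : ∀ v, d v ≤ M) (hM1 : 1 ≤ M)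
    {g : HalfEdge d → ℝ} {G : ℝ} (hg : ∀ h, |g h| ≤ G) (hG : 0 ≤ G) (hg0 : ∑ h, g h = 0) {K : ℕ}
    (hK : 2 * K ≤ Fintype.card (HalfEdge d))
    {As : List (Matrix (HalfEdge d) (HalfEdge d) ℝ)} (hAs : ∀ A ∈ As, IsLocalKernel A)
    {T : Finset (HalfEdge d)} {E : Finset (Pairing d)} (hE : Reveals T E)
    (hT : T.card + 2 * As.length + 1 ≤ K) {h : HalfEdge d} (hh : h ∉ T) :
    |∑ σ ∈ E, word σ As g h| ≤
      (As.length + 1) * (M * K * G * (2 / Fintype.card (HalfEdge d))) * E.card := by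
  set q : ℝ := 2 / Fintype.card (HalfEdge d) with hq
  have hq0 : 0 ≤ q := by positivity
  have hi : (insert h T).card = T.card + 1 := Finset.card_insert_of_notMem hh
  have hMr : (1 : ℝ) ≤ M := by exact_mod_cast hM1
  induction As generalizing T E h with
  | nil =>
    have hne : ((insert h T)ᶜ).Nonempty := by
      rw [← Finset.card_pos, Finset.card_compl, hi]
      simp at hT
      omega
    obtain ⟨y₀, hy₀⟩ := hne
    have hy₀' : y₀ ∉ insert h T := by simpa using hy₀
    have h1 : ∑ σ ∈ E, word σ [] g h = (matchedTo E h y₀).card * ∑ y ∈ (insert h T)ᶜ, g y := by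
      rw [hE.sum_eq hh, Finset.mul_sum]
      refine Finset.sum_congr rfl fun y hy => ?_
      have hy' : y ∉ insert h T := by simpa using hy
      rw [Finset.sum_congr rfl (g := fun _ => g y) fun σ hσ => by
        simp [word, (mem_matchedTo.1 hσ).2]]
      rw [Finset.sum_const, nsmul_eq_mul,
        le_antisymm (hE.card_matchedTo_le hy' hy₀') (hE.card_matchedTo_le hy₀' hy')]
    have h2 : |∑ y ∈ (insert h T)ᶜ, g y| ≤ K * G := by
      have h3 := Finset.sum_add_sum_compl (insert h T) g
      -- As `g` has total sum zero, its sum over the unrevealed half-edges is minus its sum over the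
      -- at most `K` revealed ones.
      rw [hg0] at h3
      rw [show ∑ y ∈ (insert h T)ᶜ, g y = -∑ y ∈ insert h T, g y by linarith, abs_neg]
      calc |∑ y ∈ insert h T, g y| ≤ ∑ y ∈ insert h T, |g y| := Finset.abs_sum_le_sum_abs _ _
        _ ≤ (insert h T).card • G := Finset.sum_le_card_nsmul _ _ _ fun y _ => hg y
        _ ≤ K * G := by
          rw [nsmul_eq_mul]
          refine mul_le_mul_of_nonneg_right ?_ hG
          rw [hi]
          exact_mod_cast (by simpa using hT : T.card + 1 ≤ K)
    rw [h1, abs_mul, Nat.abs_cast]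
    calc ((matchedTo E h y₀).card : ℝ) * |∑ y ∈ (insert h T)ᶜ, g y|
        ≤ (q * E.card) * (K * G) :=
          mul_le_mul (hE.card_matchedTo_le_div hh hy₀' (by simp at hT; omega)) h2
            (abs_nonneg _) (by positivity)
      _ = 1 * (K * G * q * E.card) := by ring
      _ ≤ M * (K * G * q * E.card) := mul_le_mul_of_nonneg_right hMr (by positivity)
      _ = _ := by simp; ring
  | cons A As ih =>
    have hA : IsLocalKernel A := hAs A (by simp)
    have hAs' : ∀ B ∈ As, IsLocalKernel B := fun B hB => hAs B (by simp [hB])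
    simp only [List.length_cons] at hT
    set c : ℝ := (As.length + 1) * (M * K * G * q) with hc
    have hc0 : 0 ≤ c := by positivity
    -- Collisions: the partner of `h` lies at a vertex already seen. There only the trivial bound
    -- `G` is used, at a cost of `M * K` half-edges of conditional probability at most `q` each.
    let B := Finset.univ.filter fun y : HalfEdge d => y.1 ∈ (insert h T).image Sigma.fst
    have hB : (B.card : ℝ) ≤ M * K := by
      have := (card_filter_fst_mem_le hM (insert h T)).trans
        (Nat.mul_le_mul_left M (by omega : (insert h T).card ≤ K))
      exact_mod_cast this
    have key : ∀ y ∈ (insert h T)ᶜ, |∑ σ ∈ matchedTo E h y, word σ (A :: As) g h| ≤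
        c * (matchedTo E h y).card + if y ∈ B then G * (q * E.card) else 0 := by
      intro y hy
      have hy' : y ∉ insert h T := by simpa using hy
      have h1 : ∑ σ ∈ matchedTo E h y, word σ (A :: As) g h =
          A.mulVec (fun z => ∑ σ ∈ matchedTo E h y, word σ As g z) y := by
        rw [← sum_mulVec]
        refine Finset.sum_congr rfl fun σ hσ => ?_
        rw [word, (mem_matchedTo.1 hσ).2]
      split_ifs with hyB
      · have h2 : |∑ σ ∈ matchedTo E h y, word σ (A :: As) g h| ≤
            (matchedTo E h y).card * G := by
          refine (Finset.abs_sum_le_sum_abs _ _).trans ?_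
          rw [← nsmul_eq_mul]
          exact Finset.sum_le_card_nsmul _ _ _ fun σ _ => abs_word_le σ hAs hg h
        have h3 := mul_le_mul_of_nonneg_left
          (hE.card_matchedTo_le_div hh hy' (by omega)) hG
        have h4 : 0 ≤ c * (matchedTo E h y).card := by positivity
        linarith
      · rw [h1, add_zero]
        refine hA.abs_mulVec_le (fun z hz => ?_) (by positivity)
        -- At a fresh vertex only `y` has been revealed, and the kernel moves off `y`, so the
        -- induction hypothesis applies at `z`.
        have hzT : z ∉ insert y (insert h T) := by
          rw [Finset.mem_insert, not_or]
          refine ⟨hA.ne y z hz, fun hzT => hyB ?_⟩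
          rw [Finset.mem_filter]
          refine ⟨Finset.mem_univ _, ?_⟩
          rw [← hA.fst_eq y z hz]
          exact Finset.mem_image_of_mem _ hzT
        refine ih hAs' (hE.restrict h y) ?_ hzT ?_
        · rw [Finset.card_insert_of_notMem hy']
          omega
        · exact Finset.card_insert_of_notMem hzT
    rw [hE.sum_eq hh]
    calc |∑ y ∈ (insert h T)ᶜ, ∑ σ ∈ matchedTo E h y, word σ (A :: As) g h|
        ≤ ∑ y ∈ (insert h T)ᶜ, |∑ σ ∈ matchedTo E h y, word σ (A :: As) g h| :=
          Finset.abs_sum_le_sum_abs _ _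
      _ ≤ ∑ y ∈ (insert h T)ᶜ, (c * (matchedTo E h y).card +
            if y ∈ B then G * (q * E.card) else 0) := Finset.sum_le_sum key
      _ = c * E.card + ∑ y ∈ (insert h T)ᶜ, if y ∈ B then G * (q * E.card) else 0 := by
          rw [Finset.sum_add_distrib, ← Finset.mul_sum, hE.sum_card_matchedTo hh]
      _ ≤ c * E.card + ∑ y, if y ∈ B then G * (q * E.card) else 0 := by
          gcongr
          exact Finset.subset_univ _
      _ = c * E.card + B.card * (G * (q * E.card)) := by
          rw [Finset.sum_ite_mem, Finset.univ_inter, Finset.sum_const, nsmul_eq_mul]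
      _ ≤ c * E.card + (M * K) * (G * (q * E.card)) := by gcongr
      _ = _ := by rw [hc]; push_cast [List.length_cons]; ring

end Words

/-! ### The non-backtracking walk and its ℓ² decay -/

section Walk

variable {V : Type*} {d : V → ℕ} [DecidableEq V]

/-- The law of the half-edge along which the non-backtracking walk leaves a vertex, given the
half-edge through which it has entered. -/
def turn (d : V → ℕ) : Matrix (HalfEdge d) (HalfEdge d) ℝ :=
  fun y z => if z.1 = y.1 ∧ z ≠ y then 1 / ((d z.1 : ℝ) - 1) else 0

theorem turn_symm : (turn d).IsSymm := by
  ext y z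
  simp only [Matrix.transpose_apply, turn]
  by_cases h : z.1 = y.1
  · simp [h, ne_comm]
  · rw [if_neg (fun h' => h h'.1.symm), if_neg (fun h' => h h'.1)]

theorem turn_nonneg (hd : ∀ v, 3 ≤ d v) (y z : HalfEdge d) : 0 ≤ turn d y z := by
  rw [turn]
  split_ifs
  · have : (3 : ℝ) ≤ d z.1 := by exact_mod_cast hd z.1
    exact one_div_nonneg.2 (by linarith)
  · exact le_rfl

variable [Fintype V]

/-- The off-diagonal part of the square of `turn d`. -/
def turnSqOffDiag (d : V → ℕ) : Matrix (HalfEdge d) (HalfEdge d) ℝ :=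
  fun y z => if z = y then 0 else (turn d * turn d) y z

theorem card_filter_sameVertex (y : HalfEdge d) :
    (Finset.univ.filter fun z : HalfEdge d => z.1 = y.1 ∧ z ≠ y).card = d y.1 - 1 := by
  have h1 : (Finset.univ.filter fun z : HalfEdge d => z.1 = y.1 ∧ z ≠ y) =
      (({y.1} : Finset V).sigma fun _ => Finset.univ).erase y := by
    ext z; simp [and_comm]
  rw [h1, Finset.card_erase_of_mem (by simp), Finset.card_sigma]
  simp

theorem sum_turn (hd : ∀ v, 3 ≤ d v) (y : HalfEdge d) : ∑ z, turn d y z = 1 := by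
  have h1 : ∀ z, turn d y z = if z.1 = y.1 ∧ z ≠ y then 1 / ((d y.1 : ℝ) - 1) else 0 := by
    intro z
    rw [turn]
    by_cases h : z.1 = y.1 ∧ z ≠ y
    · rw [if_pos h, if_pos h, h.1]
    · rw [if_neg h, if_neg h]
  have h3 : (3 : ℝ) ≤ d y.1 := by exact_mod_cast hd y.1
  simp_rw [h1]
  rw [← Finset.sum_filter, Finset.sum_const, card_filter_sameVertex, nsmul_eq_mul,
    Nat.cast_sub (by linarith [hd y.1]), Nat.cast_one, mul_one_div_cancel (by linarith)]

theorem isLocalKernel_turn (hd : ∀ v, 3 ≤ d v) : IsLocalKernel (turn d) := by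
  refine ⟨fun y z h => ?_, fun y z h => ?_, fun y => ?_⟩
  · by_contra hzy
    simp [turn, hzy] at h
  · by_contra hzy
    simp [turn, hzy] at h
  · simp_rw [abs_of_nonneg (turn_nonneg hd y _)]
    exact (sum_turn hd y).le

/-- Every entry of `turn d` is at most `1 / (3 - 1)`. This is the source of the geometric decay. -/
theorem turn_sq_diag_le (hd : ∀ v, 3 ≤ d v) (y : HalfEdge d) :
    (turn d * turn d) y y ≤ 1 / 2 := by
  rw [Matrix.mul_apply]
  have h1 : ∀ z, turn d z y ≤ 1 / 2 := by
    intro z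
    rw [turn]
    split_ifs
    · have : (3 : ℝ) ≤ d y.1 := by exact_mod_cast hd y.1
      exact one_div_le_one_div_of_le (by norm_num) (by linarith)
    · norm_num
  calc ∑ z, turn d y z * turn d z y ≤ ∑ z, turn d y z * (1 / 2) :=
        Finset.sum_le_sum fun z _ => mul_le_mul_of_nonneg_left (h1 z) (turn_nonneg hd y z)
    _ = 1 / 2 := by rw [← Finset.sum_mul, sum_turn hd, one_mul]

theorem turn_sq_nonneg (hd : ∀ v, 3 ≤ d v) (y z : HalfEdge d) : 0 ≤ (turn d * turn d) y z := by
  rw [Matrix.mul_apply]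
  exact Finset.sum_nonneg fun w _ => mul_nonneg (turn_nonneg hd y w) (turn_nonneg hd w z)

theorem isLocalKernel_turnSqOffDiag (hd : ∀ v, 3 ≤ d v) : IsLocalKernel (turnSqOffDiag d) := by
  refine ⟨fun y z h => ?_, fun y z h => ?_, fun y => ?_⟩
  · by_contra hzy
    simp [turnSqOffDiag, hzy] at h
  · by_contra hzy
    apply h
    rw [turnSqOffDiag]
    split_ifs with h0
    · rfl
    rw [Matrix.mul_apply]
    refine Finset.sum_eq_zero fun w _ => ?_
    by_cases hw : turn d y w = 0
    · rw [hw, zero_mul]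
    · have := (isLocalKernel_turn hd).fst_eq y w hw
      rw [turn, turn, if_neg (c := z.1 = w.1 ∧ z ≠ w), mul_zero]
      rw [this]
      exact fun h' => hzy h'.1
  · calc ∑ z, |turnSqOffDiag d y z| ≤ ∑ z, (turn d * turn d) y z := by
          refine Finset.sum_le_sum fun z _ => ?_
          rw [turnSqOffDiag]
          split_ifs
          · rw [abs_zero]
            exact turn_sq_nonneg hd y z
          · rw [abs_of_nonneg (turn_sq_nonneg hd y z)]
      _ = ∑ w, turn d y w * ∑ z, turn d w z := by
          simp_rw [Matrix.mul_apply, Finset.mul_sum]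
          exact Finset.sum_comm
      _ = 1 := by simp [sum_turn hd]

/-- Cauchy–Schwarz in each row, then column sums equal to 1 by symmetry. -/
theorem sum_sq_turn_le (hd : ∀ v, 3 ≤ d v) (f : HalfEdge d → ℝ) :
    ∑ h, ((turn d).mulVec f h) ^ 2 ≤ ∑ h, f h ^ 2 := by
  have h1 : ∀ h, ((turn d).mulVec f h) ^ 2 ≤ (turn d).mulVec (fun z => f z ^ 2) h := by
    intro h
    have := Finset.sum_sq_le_sum_mul_sum_of_sq_le_mul Finset.univ
      (r := fun z => turn d h z * f z) (f := fun z => turn d h z)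
      (g := fun z => turn d h z * f z ^ 2)
      (fun z _ => turn_nonneg hd h z) (fun z _ => mul_nonneg (turn_nonneg hd h z) (sq_nonneg _))
      (fun z _ => le_of_eq (by ring))
    rwa [sum_turn hd, one_mul] at this
  refine (Finset.sum_le_sum fun h _ => h1 h).trans (le_of_eq ?_)
  have := sum_mulVec_mul turn_symm (fun z : HalfEdge d => f z ^ 2) (fun _ => 1)
  simp only [mul_one] at this
  rw [this]
  refine Finset.sum_congr rfl fun h _ => ?_
  simp [Matrix.mulVec, dotProduct, sum_turn hd]

theorem sum_sq_turn_le_half (hd : ∀ v, 3 ≤ d v) (f : HalfEdge d → ℝ) :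
    ∑ h, ((turn d).mulVec f h) ^ 2 ≤
      1 / 2 * ∑ h, f h ^ 2 + ∑ h, (turnSqOffDiag d).mulVec f h * f h := by
  have h1 : ∀ h, (turn d * turn d).mulVec f h =
      (turn d * turn d) h h * f h + (turnSqOffDiag d).mulVec f h := by
    intro h
    have h2 : ∀ z, (turn d * turn d) h z * f z =
        (if z = h then (turn d * turn d) h h * f h else 0) + turnSqOffDiag d h z * f z := by
      intro z
      rw [turnSqOffDiag]
      split_ifs with hz <;> simp [hz]
    simp only [Matrix.mulVec, dotProduct]
    rw [Finset.sum_congr rfl fun z _ => h2 z, Finset.sum_add_distrib, Finset.sum_ite_eq',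
      if_pos (Finset.mem_univ h)]
  calc ∑ h, ((turn d).mulVec f h) ^ 2
      = ∑ h, f h * (turn d * turn d).mulVec f h := by
        simp_rw [sq, ← Matrix.mulVec_mulVec]
        exact sum_mulVec_mul turn_symm _ _
    _ = ∑ h, ((turn d * turn d) h h * f h ^ 2 + (turnSqOffDiag d).mulVec f h * f h) := by
        refine Finset.sum_congr rfl fun h _ => ?_
        rw [h1]
        ring
    _ ≤ ∑ h, (1 / 2 * f h ^ 2 + (turnSqOffDiag d).mulVec f h * f h) := by
        refine Finset.sum_le_sum fun h _ => ?_
        have := mul_le_mul_of_nonneg_right (turn_sq_diag_le hd h) (sq_nonneg (f h))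
        linarith
    _ = _ := by rw [Finset.sum_add_distrib, Finset.mul_sum]

theorem word_replicate_sub_const (hd : ∀ v, 3 ≤ d v) (σ : Pairing d) (g : HalfEdge d → ℝ) (c : ℝ)
    (k : ℕ) (h : HalfEdge d) :
    word σ (List.replicate k (turn d)) (fun x => g x - c) h =
      word σ (List.replicate k (turn d)) g h - c := by
  induction k generalizing h with
  | zero => rfl
  | succ k ih =>
    simp only [List.replicate_succ, word, Matrix.mulVec, dotProduct, ih, mul_sub,
      Finset.sum_sub_distrib]
    rw [← Finset.sum_mul, sum_turn hd, one_mul]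

/-- Duality between the forward evolution of the law and the backward evolution of the observable;
`k` turns go with `k + 1` edge crossings. -/
theorem sum_stepLaw_mul (σ : Pairing d) (i : V) (k : ℕ) (g : HalfEdge d → ℝ) :
    ∑ h, stepLaw σ i k h * g (σ.1 h) =
      1 / (d i : ℝ) * ∑ a, word σ (List.replicate k (turn d)) g ⟨i, a⟩ := by
  induction k generalizing g with
  | zero =>
    simp only [stepLaw, List.replicate_zero, word]
    rw [Fintype.sum_sigma, Finset.sum_eq_single i, Finset.mul_sum]
    · simp
    · intro j _ hj
      simp [hj]
    · simp
  | succ k ih =>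
    rw [List.replicate_succ', word_append, ← ih]
    simp only [stepLaw, Finset.sum_mul]
    rw [Finset.sum_comm]
    refine Finset.sum_congr rfl fun h _ => ?_
    simp only [mul_assoc, Matrix.mulVec, dotProduct, Finset.mul_sum, turn, word]

theorem bias_succ_add (hd : ∀ v, 3 ≤ d v) (σ : Pairing d) (k : ℕ) (i : V) (c : ℝ) :
    bias σ (k + 1) i - (c - d i) =
      1 / (d i : ℝ) * ∑ a, word σ (List.replicate k (turn d)) (fun h => d h.1 - c) ⟨i, a⟩ := by
  have h1 : ∑ j, transitionProb σ (k + 1) i j * (d j : ℝ) =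
      ∑ h, stepLaw σ i k h * (d (σ.1 h).1 : ℝ) := by
    simp only [transitionProb, Finset.sum_mul]
    rw [Finset.sum_comm]
    simp
  have h3 : (d i : ℝ) ≠ 0 := by
    have := hd i
    exact_mod_cast (by omega : d i ≠ 0)
  rw [bias, h1, sum_stepLaw_mul σ i k fun h => (d h.1 : ℝ)]
  simp_rw [word_replicate_sub_const hd]
  rw [Finset.sum_sub_distrib, Finset.sum_const, Finset.card_univ, Fintype.card_fin, nsmul_eq_mul]
  field_simp
  ring

/-- The squared norm of the `k`-step averages of `g`. -/
def normSq (σ : Pairing d) (g : HalfEdge d → ℝ) (k : ℕ) : ℝ :=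
  ∑ h, word σ (List.replicate k (turn d)) g h ^ 2

theorem sum_sq_bias_le (hd : ∀ v, 3 ≤ d v) (σ : Pairing d) (k : ℕ) (c : ℝ) :
    ∑ i, (bias σ (k + 1) i - (c - d i)) ^ 2 ≤ normSq σ (fun h => d h.1 - c) k := by
  rw [normSq, Fintype.sum_sigma]
  refine Finset.sum_le_sum fun i _ => ?_
  rw [bias_succ_add hd]
  have h3 : (3 : ℝ) ≤ d i := by exact_mod_cast hd i
  set w := fun a => word σ (List.replicate k (turn d)) (fun h => d h.1 - c) ⟨i, a⟩
  have h1 : (∑ a, w a) ^ 2 ≤ d i * ∑ a, w a ^ 2 := by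
    simpa using sq_sum_le_card_mul_sum_sq (s := Finset.univ) (f := w)
  have h2 : 0 ≤ ∑ a, w a ^ 2 := Finset.sum_nonneg fun a _ => sq_nonneg _
  rw [mul_pow, div_pow, one_pow, div_mul_eq_mul_div, one_mul, div_le_iff₀ (by positivity)]
  nlinarith

theorem normSq_succ_eq (σ : Pairing d) (g : HalfEdge d → ℝ) (k : ℕ) : normSq σ g (k + 1) =
    ∑ h, ((turn d).mulVec (word σ (List.replicate k (turn d)) g) h) ^ 2 := by
  rw [normSq, ← σ.sum_comp]
  simp [List.replicate_succ, word, σ.apply_apply]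

theorem normSq_antitone (hd : ∀ v, 3 ≤ d v) (σ : Pairing d) (g : HalfEdge d → ℝ) :
    Antitone (normSq σ g) :=
  antitone_nat_of_succ_le fun k => by
    rw [normSq_succ_eq]
    exact sum_sq_turn_le hd _

theorem normSq_succ_le (hd : ∀ v, 3 ≤ d v) (σ : Pairing d) (g : HalfEdge d → ℝ) (k : ℕ) :
    normSq σ g (k + 1) ≤ 1 / 2 * normSq σ g k + ∑ h, g h *
      word σ (List.replicate k (turn d) ++ turnSqOffDiag d :: List.replicate k (turn d)) g h := by
  rw [normSq_succ_eq]
  refine (sum_sq_turn_le_half hd _).trans (le_of_eq ?_)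
  rw [normSq]
  congr 1
  -- The `k`-turn word on one factor moves to the other by self-adjointness, giving a single word of
  -- length `2k + 1` tested against `g`.
  simp_rw [mul_comm ((turnSqOffDiag d).mulVec _ _)]
  rw [sum_word_mul σ (fun A hA => by rw [List.eq_of_mem_replicate hA]; exact turn_symm),
    List.reverse_replicate, word_append]

theorem normSq_zero_le (σ : Pairing d) {g : HalfEdge d → ℝ} {G : ℝ} (hg : ∀ h, |g h| ≤ G) :
    normSq σ g 0 ≤ Fintype.card (HalfEdge d) * G ^ 2 := by
  rw [normSq]
  refine (Finset.sum_le_card_nsmul _ _ (G ^ 2) fun h _ => ?_).trans (by simp)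
  exact sq_le_sq' (abs_le.1 (hg _)).1 (abs_le.1 (hg _)).2

theorem sum_normSq_le {M : ℕ} (hM : ∀ v, d v ≤ M) (hM1 : 1 ≤ M) (hd : ∀ v, 3 ≤ d v)
    {g : HalfEdge d → ℝ} {G : ℝ} (hg : ∀ h, |g h| ≤ G) (hG : 0 ≤ G) (hg0 : ∑ h, g h = 0) (k : ℕ)
    (hk : 8 * k ≤ Fintype.card (HalfEdge d)) :
    ∑ σ : Pairing d, normSq σ g k ≤
      ((1 / 2) ^ k * (Fintype.card (HalfEdge d) * G ^ 2) + 16 * M * G ^ 2 * k ^ 3) *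
        Fintype.card (Pairing d) := by
  induction k with
  | zero =>
    refine (Finset.sum_le_card_nsmul _ _ _ fun σ _ => normSq_zero_le σ hg).trans (le_of_eq ?_)
    simp
    ring
  | succ k ih =>
    have ih := ih (by omega)
    set l : ℝ := (Fintype.card (HalfEdge d) : ℝ)
    set p : ℝ := (Fintype.card (Pairing d) : ℝ)
    have hl : 0 < l := Nat.cast_pos.2 (by omega)
    have hp : 0 ≤ p := by positivity
    let As := List.replicate k (turn d) ++ turnSqOffDiag d :: List.replicate k (turn d)
    have hAs : ∀ A ∈ As, IsLocalKernel A := by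
      intro A hA
      simp only [As, List.mem_append, List.mem_cons] at hA
      rcases hA with hA | rfl | hA
      · rw [List.eq_of_mem_replicate hA]; exact isLocalKernel_turn hd
      · exact isLocalKernel_turnSqOffDiag hd
      · rw [List.eq_of_mem_replicate hA]; exact isLocalKernel_turn hd
    have hlen : As.length = 2 * k + 1 := by simp [As]; omega
    have h1 : ∀ h, |∑ σ : Pairing d, word σ As g h| ≤
        (2 * k + 2) * (M * (4 * k + 3) * G * (2 / l)) * p := by
      intro h
      -- Two half-edges for each of the `2k + 1` letters, plus one for the starting half-edge.
      have := reveals_univ.abs_sum_word_le (K := 4 * k + 3) hM hM1 hg hG hg0 (by omega) hAs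
        (by rw [hlen]; simp; omega) (Finset.notMem_empty h)
      refine this.trans (le_of_eq ?_)
      rw [hlen, Finset.card_univ]
      push_cast
      ring
    have h2 : ∑ σ : Pairing d, ∑ h, g h * word σ As g h ≤
        8 * (k + 1) ^ 2 * 2 * M * G ^ 2 * p := by
      rw [Finset.sum_comm]
      calc ∑ h, ∑ σ : Pairing d, g h * word σ As g h
          ≤ ∑ _h : HalfEdge d, G * ((2 * k + 2) * (M * (4 * k + 3) * G * (2 / l)) * p) := by
            refine Finset.sum_le_sum fun h _ => ?_
            rw [← Finset.mul_sum]
            refine (le_abs_self _).trans ?_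
            rw [abs_mul]
            exact mul_le_mul (hg h) (h1 h) (abs_nonneg _) hG
        _ = (2 * k + 2) * (4 * k + 3) * (2 * M * G ^ 2 * p) := by
            rw [Finset.sum_const, Finset.card_univ, nsmul_eq_mul]
            change l * _ = _
            field_simp
        _ ≤ 8 * (k + 1) ^ 2 * (2 * M * G ^ 2 * p) := by
            refine mul_le_mul_of_nonneg_right ?_ (by positivity)
            nlinarith [(Nat.cast_nonneg k : (0 : ℝ) ≤ k)]
        _ = 8 * (k + 1) ^ 2 * 2 * M * G ^ 2 * p := by ring
    calc ∑ σ : Pairing d, normSq σ g (k + 1)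
        ≤ ∑ σ : Pairing d, (1 / 2 * normSq σ g k + ∑ h, g h * word σ As g h) :=
          Finset.sum_le_sum fun σ _ => normSq_succ_le hd σ g k
      _ = 1 / 2 * ∑ σ : Pairing d, normSq σ g k + ∑ σ : Pairing d, ∑ h, g h * word σ As g h := by
          rw [Finset.sum_add_distrib, Finset.mul_sum]
      _ ≤ 1 / 2 * (((1 / 2) ^ k * (l * G ^ 2) + 16 * M * G ^ 2 * k ^ 3) * p) +
            8 * (k + 1) ^ 2 * 2 * M * G ^ 2 * p := by gcongr
      _ = ((1 / 2) ^ (k + 1) * (l * G ^ 2) +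
            16 * M * G ^ 2 * (1 / 2 * k ^ 3 + (k + 1) ^ 2)) * p := by ring
      _ ≤ _ := by
          gcongr
          push_cast
          have : (0 : ℝ) ≤ k := Nat.cast_nonneg k
          -- The cubic term closes the recursion because `k³ / 2 + (k + 1)² ≤ (k + 1)³`.
          nlinarith [pow_nonneg this 3, pow_nonneg this 2]

end Walk

/-! ### Empirical averages and the mean squared error -/

section Averages

theorem integral_uniformOn_univ {α : Type*} [Fintype α] [MeasurableSpace α]
    [MeasurableSingletonClass α] (f : α → ℝ) :
    ∫ x, f x ∂(uniformOn Set.univ : Measure α) = (Fintype.card α : ℝ)⁻¹ * ∑ x, f x := by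
  rw [uniformOn, ProbabilityTheory.cond, integral_smul_measure, Measure.restrict_univ,
    integral_fintype (f := f) (Integrable.of_finite)]
  simp

instance {V : Type*} (d : V → ℕ) : DiscreteMeasurableSpace (Pairing d) := ⟨fun _ => trivial⟩

section Finite

variable {V : Type*} [Fintype V] {d : V → ℕ}

theorem integral_configurationModel (f : Pairing d → ℝ) :
    ∫ σ, f σ ∂(configurationModel d) = (Fintype.card (Pairing d) : ℝ)⁻¹ * ∑ σ, f σ :=
  integral_uniformOn_univ f

/-- The mean degree at the end of a uniform half-edge. -/
def sizeBiasedMean (d : V → ℕ) : ℝ := (∑ i, (d i : ℝ) ^ 2) / ∑ i, (d i : ℝ)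

theorem sizeBiasedMean_nonneg (d : V → ℕ) : 0 ≤ sizeBiasedMean d := by
  unfold sizeBiasedMean
  positivity

variable [Nonempty V]

theorem sum_degree_pos (hd : ∀ v, 3 ≤ d v) : (0 : ℝ) < ∑ i, (d i : ℝ) :=
  Finset.sum_pos (fun i _ => by have := hd i; exact_mod_cast (by omega : 0 < d i))
    Finset.univ_nonempty

theorem sizeBiasedMean_le {M : ℕ} (hM : ∀ v, d v ≤ M) (hd : ∀ v, 3 ≤ d v) :
    sizeBiasedMean d ≤ M := by
  rw [sizeBiasedMean, div_le_iff₀ (sum_degree_pos hd), Finset.mul_sum]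
  refine Finset.sum_le_sum fun i _ => ?_
  have : (d i : ℝ) ≤ M := by exact_mod_cast hM i
  nlinarith [(Nat.cast_nonneg (d i) : (0 : ℝ) ≤ d i)]

variable [DecidableEq V]

theorem integral_biasEmpirical (σ : Pairing d) (k : ℕ) (f : ℝ → ℝ) :
    ∫ x, f x ∂(biasEmpirical σ k : Measure ℝ) =
      (Fintype.card V : ℝ)⁻¹ * ∑ i, f (bias σ k i) := by
  rw [biasEmpirical, ProbabilityMeasure.coe_mk, integral_smul_measure,
    integral_finsetSum_measure fun i _ => integrable_dirac (by simp)]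
  simp

/-- The squared distance of the biases from `sizeBiasedMean d - d i`, averaged over `i`. -/
def meanSqError (σ : Pairing d) (k : ℕ) : ℝ :=
  (Fintype.card V : ℝ)⁻¹ * ∑ i, (bias σ k i - (sizeBiasedMean d - d i)) ^ 2

theorem meanSqError_nonneg (σ : Pairing d) (k : ℕ) : 0 ≤ meanSqError σ k := by
  unfold meanSqError
  positivity

theorem average_meanSqError_le [Nonempty (Pairing d)] {M : ℕ} (hM : ∀ v, d v ≤ M)
    (hd : ∀ v, 3 ≤ d v) {k K : ℕ} (hk : K + 1 ≤ k) (hK : 8 * K ≤ Fintype.card V) :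
    (Fintype.card (Pairing d) : ℝ)⁻¹ * ∑ σ : Pairing d, meanSqError σ k ≤
      (M : ℝ) ^ 3 * (1 / 2) ^ K + 16 * (M : ℝ) ^ 3 * K ^ 3 * (Fintype.card V : ℝ)⁻¹ := by
  obtain ⟨k, rfl⟩ : ∃ j, k = j + 1 := ⟨k - 1, by omega⟩
  have hcard : Fintype.card (HalfEdge d) = ∑ v, d v := by simp
  have hn : (0 : ℝ) < Fintype.card V := Nat.cast_pos.2 Fintype.card_pos
  have hp : (0 : ℝ) < Fintype.card (Pairing d) := Nat.cast_pos.2 Fintype.card_pos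
  have hM1 : 1 ≤ M := by
    have v : V := Classical.arbitrary V
    have := hd v
    have := hM v
    omega
  have hl : (Fintype.card (HalfEdge d) : ℝ) ≤ M * Fintype.card V := by
    have : Fintype.card (HalfEdge d) ≤ Fintype.card V * M := by
      rw [hcard]
      simpa using Finset.sum_le_card_nsmul Finset.univ d M fun v _ => hM v
    rw [mul_comm]
    exact_mod_cast this
  have hl' : 8 * K ≤ Fintype.card (HalfEdge d) := by
    have : Fintype.card V * 3 ≤ Fintype.card (HalfEdge d) := by
      rw [hcard]
      simpa using Finset.card_nsmul_le_sum Finset.univ d 3 fun v _ => hd v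
    omega
  set g : HalfEdge d → ℝ := fun h => d h.1 - sizeBiasedMean d with hg
  have hgM : ∀ h, |g h| ≤ M := by
    intro h
    have h1 : (d h.1 : ℝ) ≤ M := by exact_mod_cast hM h.1
    have h2 := sizeBiasedMean_le hM hd
    have h3 := sizeBiasedMean_nonneg d
    have h4 : (0 : ℝ) ≤ d h.1 := Nat.cast_nonneg _
    rw [abs_le]
    constructor <;> simp only [hg] <;> linarith
  have hg0 : ∑ h, g h = 0 := by
    rw [Fintype.sum_sigma]
    simp only [hg, Finset.sum_const, Finset.card_univ, Fintype.card_fin, nsmul_eq_mul, mul_sub,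
      Finset.sum_sub_distrib]
    rw [← Finset.sum_mul, sizeBiasedMean, mul_div_cancel₀ _ (sum_degree_pos hd).ne']
    simp [sq]
  have hle : ∀ σ : Pairing d, meanSqError σ (k + 1) ≤ (Fintype.card V : ℝ)⁻¹ * normSq σ g K := by
    intro σ
    refine mul_le_mul_of_nonneg_left ?_ (by positivity)
    -- Monotonicity trades the actual number of turns for the smaller `K`, which can be held fixed
    -- as the graph grows.
    exact (sum_sq_bias_le hd σ k _).trans (normSq_antitone hd σ g (by omega))
  calc (Fintype.card (Pairing d) : ℝ)⁻¹ * ∑ σ : Pairing d, meanSqError σ (k + 1)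
      ≤ (Fintype.card (Pairing d) : ℝ)⁻¹ *
          ((Fintype.card V : ℝ)⁻¹ * ∑ σ : Pairing d, normSq σ g K) := by
        rw [Finset.mul_sum (a := (Fintype.card V : ℝ)⁻¹)]
        exact mul_le_mul_of_nonneg_left (Finset.sum_le_sum fun σ _ => hle σ) (by positivity)
    _ ≤ (Fintype.card (Pairing d) : ℝ)⁻¹ * ((Fintype.card V : ℝ)⁻¹ *
          (((1 / 2) ^ K * (M * Fintype.card V * M ^ 2) + 16 * M * M ^ 2 * K ^ 3) *
            Fintype.card (Pairing d))) := by
        gcongr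
        refine (sum_normSq_le hM hM1 hd hgM (by positivity) hg0 K hl').trans ?_
        gcongr
    _ = _ := by
        field_simp

theorem abs_integral_biasEmpirical_sub_le (σ : Pairing d) (k : ℕ) {f : ℝ → ℝ} {L : NNReal}
    (hf : LipschitzWith L f) (c : ℝ) :
    |∫ x, f x ∂(biasEmpirical σ k : Measure ℝ) -
      (Fintype.card V : ℝ)⁻¹ * ∑ i, f (c - d i)| ≤
      L * (√(meanSqError σ k) + |sizeBiasedMean d - c|) := by
  have hn : (0 : ℝ) < Fintype.card V := Nat.cast_pos.2 Fintype.card_pos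
  set e : V → ℝ := fun i => |bias σ k i - (sizeBiasedMean d - d i)| with he
  have h1 : ∀ i, |f (bias σ k i) - f (c - d i)| ≤ L * (e i + |sizeBiasedMean d - c|) := by
    intro i
    have := hf.dist_le_mul (bias σ k i) (c - d i)
    rw [Real.dist_eq, Real.dist_eq] at this
    refine this.trans (mul_le_mul_of_nonneg_left ?_ L.2)
    refine le_trans (le_of_eq ?_) (abs_add_le _ _)
    congr 1
    ring
  have h2 : (Fintype.card V : ℝ)⁻¹ * ∑ i, e i ≤ √(meanSqError σ k) := by
    apply Real.le_sqrt_of_sq_le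
    have h3 : (∑ i, e i) ^ 2 ≤ Fintype.card V * ∑ i, e i ^ 2 := by
      simpa using sq_sum_le_card_mul_sum_sq (s := Finset.univ) (f := e)
    have h4 : meanSqError σ k = (Fintype.card V : ℝ)⁻¹ * ∑ i, e i ^ 2 := by
      simp [meanSqError, he, sq_abs]
    rw [h4, mul_pow]
    calc (Fintype.card V : ℝ)⁻¹ ^ 2 * (∑ i, e i) ^ 2
        ≤ (Fintype.card V : ℝ)⁻¹ ^ 2 * (Fintype.card V * ∑ i, e i ^ 2) := by gcongr
      _ = _ := by field_simp
  rw [integral_biasEmpirical, ← mul_sub, ← Finset.sum_sub_distrib, abs_mul,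
    abs_of_pos (inv_pos.2 hn)]
  calc (Fintype.card V : ℝ)⁻¹ * |∑ i, (f (bias σ k i) - f (c - d i))|
      ≤ (Fintype.card V : ℝ)⁻¹ * ∑ i, L * (e i + |sizeBiasedMean d - c|) := by
        gcongr
        exact (Finset.abs_sum_le_sum_abs _ _).trans (Finset.sum_le_sum fun i _ => h1 i)
    _ = L * ((Fintype.card V : ℝ)⁻¹ * ∑ i, e i + |sizeBiasedMean d - c|) := by
        rw [← Finset.mul_sum, Finset.sum_add_distrib, Finset.sum_const, Finset.card_univ,
          nsmul_eq_mul]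
        field_simp
    _ ≤ _ := by gcongr

end Finite

/-! ### Passage to the limit -/

section Limit

variable {M : ℕ} {d : ∀ n : ℕ+, Fin n → ℕ} {Ω : Type*} [MeasurableSpace Ω] {P : Measure Ω}
  [IsProbabilityMeasure P] {D : Ω → ℕ}

theorem tendsto_average_of_bounded (hD_meas : Measurable D)
    (hD : TendstoInDistribution d atTop D
      (fun n => (uniformOn Set.univ : Measure (Fin n))) P)
    (f : ℕ → ℝ) (C : ℝ) (hf : ∀ x, ‖f x‖ ≤ C) :
    Tendsto (fun n : ℕ+ => ((n : ℕ) : ℝ)⁻¹ * ∑ i, f (d n i)) atTop (𝓝 (∫ ω, f (D ω) ∂P)) := by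
  have h := (ProbabilityMeasure.tendsto_iff_forall_integral_tendsto.1 hD.tendsto)
    (BoundedContinuousFunction.ofNormedAddCommGroupDiscrete f C hf)
  simp only [BoundedContinuousFunction.coe_ofNormedAddCommGroupDiscrete,
    ProbabilityMeasure.coe_mk] at h
  rw [integral_map hD_meas.aemeasurable (by fun_prop)] at h
  refine h.congr fun n => ?_
  rw [integral_map (hD.forall_aemeasurable n) (by fun_prop), integral_uniformOn_univ]
  simp

/-- On the discrete space `ℕ` the indicator of `x > M` is a continuous test function, and its
averages vanish for every `n`. The bound lets moments pass to the limit by truncation. -/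
theorem ae_le_of_tendstoInDistribution (hM : ∀ n i, d n i ≤ M) (hD_meas : Measurable D)
    (hD : TendstoInDistribution d atTop D
      (fun n => (uniformOn Set.univ : Measure (Fin n))) P) : ∀ᵐ ω ∂P, D ω ≤ M := by
  have hb : ∀ x : ℕ, ‖(if x ≤ M then 0 else 1 : ℝ)‖ ≤ 1 := fun x => by split_ifs <;> simp
  have h := tendsto_average_of_bounded hD_meas hD (fun x => if x ≤ M then 0 else 1) 1 hb
  simp only [hM, if_true, Finset.sum_const_zero, mul_zero] at h
  have h0 := tendsto_nhds_unique h tendsto_const_nhds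
  have hint : Integrable (fun ω => if D ω ≤ M then (0 : ℝ) else 1) P :=
    Integrable.of_bound (((measurable_of_countable fun x : ℕ =>
      if x ≤ M then (0 : ℝ) else 1).comp hD_meas).aestronglyMeasurable) 1
      (ae_of_all _ fun ω => hb (D ω))
  rw [integral_eq_zero_iff_of_nonneg (fun ω => by dsimp; split_ifs <;> simp) hint] at h0
  filter_upwards [h0] with ω hω
  by_contra hlt
  simp [hlt] at hω

theorem tendsto_average (hM : ∀ n i, d n i ≤ M) (hD_meas : Measurable D)
    (hD : TendstoInDistribution d atTop D
      (fun n => (uniformOn Set.univ : Measure (Fin n))) P) (f : ℕ → ℝ) :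
    Tendsto (fun n : ℕ+ => ((n : ℕ) : ℝ)⁻¹ * ∑ i, f (d n i)) atTop (𝓝 (∫ ω, f (D ω) ∂P)) := by
  have h := tendsto_average_of_bounded hD_meas hD (fun x => f (min x M))
    (∑ x ∈ Finset.range (M + 1), ‖f x‖) fun x =>
      Finset.single_le_sum (f := fun x => ‖f x‖) (fun _ _ => norm_nonneg _)
        (Finset.mem_range.2 (by omega))
  simp only [hM, min_eq_left] at h
  convert h using 2
  refine integral_congr_ae ?_
  filter_upwards [ae_le_of_tendstoInDistribution hM hD_meas hD] with ω hω
  rw [min_eq_left hω]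

theorem tendsto_sizeBiasedMean (hM : ∀ n i, d n i ≤ M) (hd : ∀ n i, 3 ≤ d n i)
    (hD_meas : Measurable D)
    (hD : TendstoInDistribution d atTop D
      (fun n => (uniformOn Set.univ : Measure (Fin n))) P) :
    Tendsto (fun n => sizeBiasedMean (d n)) atTop
      (𝓝 ((∫ ω, (D ω : ℝ) ^ 2 ∂P) / ∫ ω, (D ω : ℝ) ∂P)) := by
  have h1 := tendsto_average hM hD_meas hD fun x => (x : ℝ)
  have h2 := tendsto_average hM hD_meas hD fun x => (x : ℝ) ^ 2
  have h3 : (3 : ℝ) ≤ ∫ ω, (D ω : ℝ) ∂P := by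
    refine ge_of_tendsto' h1 fun n => ?_
    have hn : (0 : ℝ) < (n : ℕ) := Nat.cast_pos.2 n.pos
    rw [← div_eq_inv_mul, le_div_iff₀ hn]
    have : ∑ _i : Fin n, (3 : ℝ) ≤ ∑ i, (d n i : ℝ) :=
      Finset.sum_le_sum fun i _ => by exact_mod_cast hd n i
    simpa [mul_comm] using this
  refine (h2.div h1 (by linarith)).congr fun n => ?_
  have hn : ((n : ℕ) : ℝ)⁻¹ ≠ 0 := inv_ne_zero (Nat.cast_ne_zero.2 n.ne_zero)
  exact mul_div_mul_left _ _ hn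

theorem tendsto_average_meanSqError (hd_even : ∀ n, Even (∑ i, d n i)) (hM : ∀ n i, d n i ≤ M)
    (hd : ∀ n i, 3 ≤ d n i) {k : ℕ+ → ℕ} (hk : Tendsto k atTop atTop) :
    Tendsto (fun n => (Fintype.card (Pairing (d n)) : ℝ)⁻¹ *
      ∑ σ : Pairing (d n), meanSqError σ (k n)) atTop (𝓝 0) := by
  refine Metric.tendsto_nhds.2 fun ε hε => ?_
  have hpow : Tendsto (fun K : ℕ => (M : ℝ) ^ 3 * (1 / 2) ^ K) atTop (𝓝 0) := by
    simpa using (tendsto_pow_atTop_nhds_zero_of_lt_one (r := (1 / 2 : ℝ)) (by norm_num)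
      (by norm_num)).const_mul ((M : ℝ) ^ 3)
  -- `K` depends only on `ε` and `M`, so the remaining error is a constant over `n`.
  obtain ⟨K, hK⟩ := (hpow.eventually_lt_const (half_pos hε)).exists
  have hinv : Tendsto (fun n : ℕ+ => 16 * (M : ℝ) ^ 3 * K ^ 3 * ((n : ℕ) : ℝ)⁻¹) atTop (𝓝 0) := by
    have h := ((tendsto_inv_atTop_nhds_zero_nat (𝕜 := ℝ)).comp
      tendsto_PNat_val_atTop_atTop).const_mul (16 * (M : ℝ) ^ 3 * K ^ 3)
    rwa [mul_zero] at h
  filter_upwards [hinv.eventually_lt_const (half_pos hε), hk.eventually_ge_atTop (K + 1),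
    tendsto_PNat_val_atTop_atTop.eventually_ge_atTop (8 * K)] with n h1 h2 h3
  have := Pairing.nonempty_of_even (hd_even n)
  have h4 := average_meanSqError_le (hM n) (hd n) h2 (by simpa using h3)
  rw [Fintype.card_fin] at h4
  rw [Real.dist_eq, sub_zero, abs_of_nonneg]
  · linarith
  · exact mul_nonneg (by positivity) (Finset.sum_nonneg fun σ _ => meanSqError_nonneg σ _)

theorem integral_limitLaw (hD_meas : Measurable D) {f : ℝ → ℝ} (hf : Continuous f) :
    ∫ x, f x ∂(limitLaw P D hD_meas : Measure ℝ) =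
      ∫ ω, f ((∫ ω', (D ω' : ℝ) ^ 2 ∂P) / (∫ ω', (D ω' : ℝ) ∂P) - (D ω : ℝ)) ∂P := by
  rw [limitLaw, ProbabilityMeasure.coe_mk, integral_map (by fun_prop)]
  exact hf.aestronglyMeasurable

/-- The empirical distributions converge along every sequence of matchings whose mean squared error
vanishes. -/
theorem tendsto_biasEmpirical (hM : ∀ n i, d n i ≤ M) (hd : ∀ n i, 3 ≤ d n i)
    (hD_meas : Measurable D)
    (hD : TendstoInDistribution d atTop D
      (fun n => (uniformOn Set.univ : Measure (Fin n))) P) (k : ℕ+ → ℕ) :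
    Tendsto (fun p : Σ n, Pairing (d n) => biasEmpirical p.2 (k p.1))
      (comap Sigma.fst atTop ⊓
        comap (fun p : Σ n, Pairing (d n) => meanSqError p.2 (k p.1)) (𝓝 0))
      (𝓝 (limitLaw P D hD_meas)) := by
  set F := comap Sigma.fst atTop ⊓
    comap (fun p : Σ n, Pairing (d n) => meanSqError p.2 (k p.1)) (𝓝 0)
  -- Bounded Lipschitz test functions determine weak convergence, and they turn the mean squared
  -- error into a bound on integrals.
  rw [tendsto_iff_forall_lipschitz_integral_tendsto]
  rintro f - ⟨L, hL⟩
  rw [integral_limitLaw hD_meas hL.continuous]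
  set c : ℝ := (∫ ω', (D ω' : ℝ) ^ 2 ∂P) / (∫ ω', (D ω' : ℝ) ∂P)
  have hfst : Tendsto (Sigma.fst : (Σ n, Pairing (d n)) → ℕ+) F atTop :=
    tendsto_comap.mono_left inf_le_left
  have herr : Tendsto (fun p : Σ n, Pairing (d n) => meanSqError p.2 (k p.1)) F (𝓝 0) :=
    tendsto_comap.mono_left inf_le_right
  have h1 := (tendsto_average hM hD_meas hD fun x => f (c - x)).comp hfst
  have h2 := ((tendsto_sizeBiasedMean hM hd hD_meas hD).comp hfst).sub_const c
  have h3 : Tendsto (fun p : Σ n, Pairing (d n) => (L : ℝ) * (√(meanSqError p.2 (k p.1)) +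
      |sizeBiasedMean (d p.1) - c|)) F (𝓝 0) := by
    simpa [c] using ((herr.sqrt).add h2.abs).const_mul (L : ℝ)
  have h4 : Tendsto (fun p : Σ n, Pairing (d n) =>
      ∫ x, f x ∂(biasEmpirical p.2 (k p.1) : Measure ℝ) -
        ((p.1 : ℕ) : ℝ)⁻¹ * ∑ i, f (c - d p.1 i)) F (𝓝 0) := by
    refine squeeze_zero_norm (fun p => ?_) h3
    have := abs_integral_biasEmpirical_sub_le p.2 (k p.1) hL c
    rwa [Fintype.card_fin] at this
  simpa using h4.add h1

end Limit

end Averages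

end FriendshipBias

end

/-! ### Convergence in distribution of the random empirical measure -/

theorem theorem5p3
    -- for every `n ≥ 1` a degree sequence on `n` vertices, with even sum and entries in `[3, M]`
    (M : ℕ) (d : ∀ n : ℕ+, Fin n → ℕ)
    (hd_even : ∀ n, Even (∑ i, d n i))
    (hd_min : ∀ n i, 3 ≤ d n i) (hd_max : ∀ n i, d n i ≤ M)
    -- the degree of a uniformly chosen vertex converges in distribution to `D`
    {Ω : Type*} [MeasurableSpace Ω] (P : Measure Ω) [IsProbabilityMeasure P]
    (D : Ω → ℕ) (hD_meas : Measurable D) (hD_pos : ∀ᵐ ω ∂P, 1 ≤ D ω)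
    (hD : TendstoInDistribution d atTop D
      (fun n => (uniformOn Set.univ : Measure (Fin n))) P)
    -- `m n = o(√(n / d_max))`, where `d_max` is the maximal degree at size `n`
    (m : ℕ+ → ℕ)
    (hm : (fun n => (m n : ℝ)) =o[atTop]
      fun n : ℕ+ => Real.sqrt (((n : ℕ) : ℝ) / ((Finset.univ.sup (d n) : ℕ) : ℝ)))
    (k : ℕ+ → ℕ) (hk : Tendsto k atTop atTop)
    (hkm : ∀ᶠ n in atTop, (k n : ℝ) ≤ Real.log (m n) / (2 * Real.log M)) :
    FriendshipBias.RandomMeasureTendstoInDistribution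
      (fun n => FriendshipBias.configurationModel (d n))
      (fun n (σ : FriendshipBias.Pairing (d n)) => FriendshipBias.biasEmpirical σ (k n))
      atTop
      (FriendshipBias.limitLaw P D hD_meas) := by
  open FriendshipBias in
  intro Φ
  set μ := limitLaw P D hD_meas
  refine Metric.tendsto_nhds.2 fun ε hε => ?_
  have hlim := (Φ.continuous.tendsto μ).comp
    (tendsto_biasEmpirical hd_max hd_min hD_meas hD k)
  have hev := Metric.tendsto_nhds.1 hlim (ε / 2) (half_pos hε)
  -- Convergence along the filter on pairs (size, matching) yields thresholds `n₀` and `δ` uniform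
  -- over all matchings.
  obtain ⟨⟨n₀, δ⟩, ⟨-, hδ⟩, hclose⟩ := ((atTop_basis.comap Sigma.fst).inf
    (Metric.nhds_basis_ball.comap _)).eventually_iff.1 hev
  have hδ : 0 < δ := hδ
  have herr := (tendsto_average_meanSqError hd_even hd_max hd_min hk).const_mul (2 * ‖Φ‖ / δ)
  rw [mul_zero] at herr
  filter_upwards [eventually_ge_atTop n₀, herr.eventually_lt_const (half_pos hε)] with n hn hsmall
  have := Pairing.nonempty_of_even (hd_even n)
  have hp : (0 : ℝ) < Fintype.card (Pairing (d n)) := Nat.cast_pos.2 Fintype.card_pos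
  have hpt : ∀ σ : Pairing (d n),
      |Φ (biasEmpirical σ (k n)) - Φ μ| ≤ ε / 2 + 2 * ‖Φ‖ / δ * meanSqError σ (k n) := by
    intro σ
    have h0 := meanSqError_nonneg σ (k n)
    by_cases hσ : meanSqError σ (k n) < δ
    · have h1 : dist (Φ (biasEmpirical σ (k n))) (Φ μ) < ε / 2 := by
        refine @hclose ⟨n, σ⟩ ⟨hn, ?_⟩
        simpa [abs_of_nonneg h0] using hσ
      rw [Real.dist_eq] at h1
      have h2 : 0 ≤ 2 * ‖Φ‖ / δ * meanSqError σ (k n) := by positivity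
      linarith
    -- Markov's inequality in pointwise form: where the error is at least `δ`, the trivial bound `2
    -- * ‖Φ‖` is dominated by its multiple by error over `δ`.
    · have h1 : |Φ (biasEmpirical σ (k n)) - Φ μ| ≤ 2 * ‖Φ‖ := by
        rw [← Real.dist_eq]
        exact Φ.dist_le_two_norm _ _
      have h2 : 2 * ‖Φ‖ ≤ 2 * ‖Φ‖ / δ * meanSqError σ (k n) := by
        rw [div_mul_eq_mul_div, le_div_iff₀ hδ]
        exact mul_le_mul_of_nonneg_left (not_lt.1 hσ) (by positivity)
      linarith
  rw [integral_configurationModel, Real.dist_eq]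
  have havg : (Fintype.card (Pairing (d n)) : ℝ)⁻¹ *
      ∑ σ : Pairing (d n), Φ (biasEmpirical σ (k n)) - Φ μ =
      (Fintype.card (Pairing (d n)) : ℝ)⁻¹ *
        ∑ σ : Pairing (d n), (Φ (biasEmpirical σ (k n)) - Φ μ) := by
    rw [Finset.sum_sub_distrib, Finset.sum_const, Finset.card_univ, nsmul_eq_mul]
    field_simp
  rw [havg, abs_mul, abs_of_pos (inv_pos.2 hp)]
  calc (Fintype.card (Pairing (d n)) : ℝ)⁻¹ *
        |∑ σ : Pairing (d n), (Φ (biasEmpirical σ (k n)) - Φ μ)|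
      ≤ (Fintype.card (Pairing (d n)) : ℝ)⁻¹ *
          ∑ σ : Pairing (d n), (ε / 2 + 2 * ‖Φ‖ / δ * meanSqError σ (k n)) := by
        gcongr
        exact (Finset.abs_sum_le_sum_abs _ _).trans (Finset.sum_le_sum fun σ _ => hpt σ)
    _ = ε / 2 + 2 * ‖Φ‖ / δ * ((Fintype.card (Pairing (d n)) : ℝ)⁻¹ *
          ∑ σ : Pairing (d n), meanSqError σ (k n)) := by
        rw [Finset.sum_add_distrib, Finset.sum_const, Finset.card_univ, nsmul_eq_mul,
          ← Finset.mul_sum]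
        field_simp
    _ < ε := by linarith
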